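/- Let $k,l$ be positive integers with $l<k$, put $d=\gcd(l,k)$ and $k=nd$ (so $n>1$), and let $a\in\mathrm{GF}(2^k)$, $a\neq 0$. Let $P_a(x)=x^{2^l+1}+x+a$. Define polynomials over $\mathrm{GF}(2^k)$ by $C_1(x)=C_2(x)=1$, $C_{i+2}(x)=C_{i+1}(x)+x^{2^{il}}C_i(x)$ for $i\geq 1$, and $Z_n(x)=C_{n+1}(x)+x\,C_{n-1}(x)^{2^l}$ (recall $n>1$). Let $\mathrm{N}_d^k(x)=\prod_{i=0}^{k/d-1}x^{2^{id}}$ be the norm from $\mathrm{GF}(2^k)$ to $\mathrm{GF}(2^d)$ and $\mathrm{Tr}_d(x)=\sum_{i=0}^{d-1}x^{2^i}$ the absolute trace on $\mathrm{GF}(2^d)$. (One has $Z_n(a)\in\mathrm{GF}(2^d)$.) Then $P_a(x)$ has exactly two zeros in $\mathrm{GF}(2^k)$ if and only if $Z_n(a)\neq 0$ and $\mathrm{Tr}_d\left(\mathrm{N}_d^k(a)/Z_n(a)^2\right)=0$. Moreover, if $d$ is odd and $P_a(x)$ has exactly two zeros in $\mathrm{GF}(2^k)$, then $C_n(a)\neq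 0$ and these two zeros are $(W+\mu)Z_n(a)/C_n(a)$ for $\mu\in\{0,1\}$, where $$W=\frac{C_{n+1}(a)}{Z_n(a)}+\sum_{i=0}^{(d-1)/2}\left(\frac{\mathrm{N}_d^k(a)}{Z_n(a)^2}\right)^{2^{2i}}.$$ -/

import Mathlib

open Polynomial

namespace HellesethKholosha

/-- The polynomial `P_a(x) = x ^ (2 ^ l + 1) + x + a`. -/
noncomputable def polyP {F : Type*} [Field F] (l : ℕ) (a : F) : F[X] :=
  X ^ (2 ^ l + 1) + X + C a

/-- The polynomials `C_i(x)`: `C_1 = C_2 = 1` and `C_{i+2}(x) = C_{i+1}(x) + x_i C_i(x)` for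
`i ≥ 1`, where `x_i = x ^ (2 ^ (i l))`. The value at `0` is the usual convention `C_0 = 0`. -/
noncomputable def polyC (F : Type*) [Field F] (l : ℕ) : ℕ → F[X]
  | 0 => 0
  | 1 => 1
  | 2 => 1
  | i + 3 => polyC F l (i + 2) + X ^ (2 ^ ((i + 1) * l)) * polyC F l (i + 1)

/-- The polynomials `Z_n(x)`: `Z_1 = 1` and `Z_n(x) = C_{n+1}(x) + x C_{n-1}(x) ^ (2 ^ l)` for
`n > 1`. The value at `0` is never used. -/
noncomputable def polyZ (F : Type*) [Field F] (l : ℕ) : ℕ → F[X]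
  | 0 => 0
  | 1 => 1
  | n + 2 => polyC F l (n + 3) + X * polyC F l (n + 1) ^ (2 ^ l)

/-- The trace map `Tr_d^k` from `GF(2^k)` to `GF(2^d)`, for `d` dividing `k`. -/
def trMap {F : Type*} [Field F] (d k : ℕ) (x : F) : F :=
  ∑ i ∈ Finset.range (k / d), x ^ (2 ^ (i * d))

/-- The norm map `N_d^k` from `GF(2^k)` to `GF(2^d)`, for `d` dividing `k`. -/
def normMap {F : Type*} [Field F] (d k : ℕ) (x : F) : F :=
  ∏ i ∈ Finset.range (k / d), x ^ (2 ^ (i * d))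

/-- The absolute trace `Tr_d = Tr_1^d` of `GF(2^d)`, applied to elements of the subfield
`GF(2^d)` of `F`. -/
def absTr {F : Type*} [Field F] (d : ℕ) (x : F) : F := trMap 1 d x

/-- The element `N_d^k(a) / Z_n(a) ^ 2`. -/
noncomputable def normQuot {F : Type*} [Field F] (l k d n : ℕ) (a : F) : F :=
  normMap d k a / (polyZ F l n).eval a ^ 2

/-- The element `W = C_{n+1}(a) / Z_n(a) + ∑_{i=0}^{(d-1)/2} (N_d^k(a) / Z_n(a)^2) ^ (2 ^ (2 i))`,
used for odd `d`. -/
noncomputable def elemW {F : Type*} [Field F] (l k d n : ℕ) (a : F) : F :=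
  (polyC F l (n + 1)).eval a / (polyZ F l n).eval a +
    ∑ i ∈ Finset.range ((d - 1) / 2 + 1), normQuot l k d n a ^ (2 ^ (2 * i))

end HellesethKholosha

/-! Let `σ x = x ^ (2 ^ l)`. A zero of `P_a` satisfies `x σ(x) = x + a`, that is, `A v = x σ(v)` for
`v = (x, 1)` and `A = [[1, a], [1, 0]]`. Composing `n` twisted copies of `A` gives `M = [[C_{n+1}, a
σ(C_n)], [C_n, a σ(C_{n-1})]]`, with trace `Z_n` and determinant `N(a)`. Since `σ^n = 1`, `v` is an
eigenvector of `M` with eigenvalue `N(x)`, so `N(x)` is a root of `r^2 + Z_n r + N(a)` fixed by `σ`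
(`twistedProd_charpoly`).

If `Z_n ≠ 0`, then `C_n ≠ 0` and zeros correspond to roots `r` in `GF(2^d)` (`setOf_zeros_eq`).
Putting `r = t Z_n` gives `t^2 + t = N(a) / Z_n^2`, solvable in `GF(2^d)` exactly when the trace
vanishes. If `Z_n = 0`, all zeros have the same norm; by Hilbert 90 two of them produce a third
(`exists_third_zero`), so there are never exactly two. -/

namespace HellesethKholosha

/-! ### Continuants twisted by a field endomorphism. -/

section Twisted

variable {F : Type*} [Field F]

/-- The continuant-like sequence attached to an endomorphism `σ` of a field and an element `a`. -/
def twistedSeq (σ : F →+* F) (a : F) : ℕ → F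
  | 0 => 0
  | 1 => 1
  | i + 2 => twistedSeq σ a (i + 1) + σ^[i] a * twistedSeq σ a i

/-- The twisted product `x σ(x) ⋯ σ^(n-1)(x)`. -/
def twistedProd (σ : F →+* F) (n : ℕ) (x : F) : F :=
  ∏ i ∈ Finset.range n, σ^[i] x

lemma twistedProd_succ (σ : F →+* F) (n : ℕ) (x : F) :
    twistedProd σ (n + 1) x = twistedProd σ n x * σ^[n] x :=
  Finset.prod_range_succ _ _

lemma twistedProd_succ' (σ : F →+* F) (n : ℕ) (x : F) :
    twistedProd σ (n + 1) x = σ (twistedProd σ n x) * x := by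
  simp [twistedProd, Finset.prod_range_succ', Function.iterate_succ_apply']

lemma twistedProd_ne_zero (σ : F →+* F) (n : ℕ) {x : F} (hx : x ≠ 0) :
    twistedProd σ n x ≠ 0 := by
  refine Finset.prod_ne_zero_iff.2 fun i _ h => hx ?_
  rw [← iterate_map_zero σ i] at h
  exact σ.injective.iterate i h

lemma twistedProd_div (σ : F →+* F) (n : ℕ) (x y : F) :
    twistedProd σ n (x / y) = twistedProd σ n x / twistedProd σ n y := by
  induction n with
  | zero => simp [twistedProd]
  | succ n ih => rw [twistedProd_succ', ih, map_div₀, div_mul_div_comm, ← twistedProd_succ',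
      ← twistedProd_succ']

lemma map_twistedProd (σ : F →+* F) {n : ℕ} {x : F} (h : σ^[n] x = x) :
    σ (twistedProd σ n x) = twistedProd σ n x := by
  rcases eq_or_ne x 0 with rfl | hx
  · simp only [twistedProd, iterate_map_zero, Finset.prod_const, map_pow, map_zero]
  · have := twistedProd_succ' σ n x
    rw [twistedProd_succ, h] at this
    exact (mul_right_cancel₀ hx this).symm

lemma twistedSeq_add_two (σ : F →+* F) (a : F) (i : ℕ) :
    twistedSeq σ a (i + 2) = twistedSeq σ a (i + 1) + σ^[i] a * twistedSeq σ a i := rfl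

lemma map_twistedSeq_add_two (σ : F →+* F) (a : F) (i : ℕ) :
    σ (twistedSeq σ a (i + 2)) =
      σ (twistedSeq σ a (i + 1)) + σ^[i + 1] a * σ (twistedSeq σ a i) := by
  rw [twistedSeq_add_two, map_add, map_mul, Function.iterate_succ_apply']

/-- Expansion of the continuant at its other end; comparing the two expansions drives the lemmas
below. -/
lemma twistedSeq_add_two' (σ : F →+* F) (a : F) (i : ℕ) :
    twistedSeq σ a (i + 2) =
      σ (twistedSeq σ a (i + 1)) + σ a * σ (σ (twistedSeq σ a i)) := by
  induction i using Nat.twoStepInduction with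
  | zero => simp [twistedSeq]
  | one => simp [twistedSeq]
  | more i h1 h2 =>
    have h3 : σ (twistedSeq σ a (i + 1 + 2)) =
        σ (twistedSeq σ a (i + 2)) + σ^[i + 2] a * σ (twistedSeq σ a (i + 1)) :=
      map_twistedSeq_add_two σ a (i + 1)
    have h4 : σ (σ (twistedSeq σ a (i + 2))) =
        σ (σ (twistedSeq σ a (i + 1))) + σ^[i + 2] a * σ (σ (twistedSeq σ a i)) := by
      rw [map_twistedSeq_add_two, map_add, map_mul, Function.iterate_succ_apply' _ (i + 1)]
    have h5 := twistedSeq_add_two σ a (i + 2)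
    linear_combination h5 + h2 + σ^[i + 2] a * h1 - h3 - σ a * h4

/-- Second row of the eigenvector equation for `(x, 1)`. -/
lemma twistedSeq_eigen (σ : F →+* F) {a x : F} (hx : x * σ x = x + a) (i : ℕ) :
    twistedSeq σ a (i + 1) * x + a * σ (twistedSeq σ a i) = twistedProd σ (i + 1) x := by
  induction i using Nat.twoStepInduction with
  | zero => simp [twistedSeq, twistedProd]
  | one => simp [twistedSeq, twistedProd, Finset.prod_range_succ, hx]
  | more i h1 h2 =>
    have h3 := map_twistedSeq_add_two σ a i
    have h4 : σ^[i + 1] x * σ^[i + 2] x = σ^[i + 1] x + σ^[i + 1] a := by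
      rw [Function.iterate_succ_apply _ (i + 1), ← iterate_map_mul σ, hx, iterate_map_add σ]
    rw [twistedProd_succ, twistedProd_succ, mul_assoc, h4, mul_add, ← twistedProd_succ, ← h1,
      ← h2, twistedSeq_add_two, h3]
    ring

variable [CharP F 2]

/-- Multiplicativity of the determinant; signs vanish in characteristic 2. -/
lemma twistedSeq_det (σ : F →+* F) (a : F) (i : ℕ) :
    twistedSeq σ a (i + 2) * (a * σ (twistedSeq σ a i)) +
      a * σ (twistedSeq σ a (i + 1)) * twistedSeq σ a (i + 1) = twistedProd σ (i + 1) a := by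
  induction i with
  | zero => simp [twistedSeq, twistedProd]
  | succ i ih =>
    have h1 := twistedSeq_add_two σ a (i + 1)
    have h2 := map_twistedSeq_add_two σ a i
    rw [twistedProd_succ, ← ih, h1, h2]
    grind

/-- The twisted trace `c_{m+2} + a σ(c_m)`. -/
def twistedTrace (σ : F →+* F) (a : F) (m : ℕ) : F :=
  twistedSeq σ a (m + 2) + a * σ (twistedSeq σ a m)

variable {σ : F →+* F} {a : F} {m : ℕ}

lemma map_twistedTrace (ha : σ^[m + 1] a = a) :
    σ (twistedTrace σ a m) = twistedTrace σ a m := by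
  have h1 := twistedSeq_add_two' σ a m
  have h2 := map_twistedSeq_add_two σ a m
  rw [ha] at h2
  simp only [twistedTrace, map_add, map_mul]
  grind

/-- If `c_{m+1} = 0`, the two expansions force `c_{m+2} = σ(c_{m+2}) = a σ(c_m)`, so the two terms
of the trace cancel. -/
lemma twistedSeq_ne_zero (ha : σ^[m + 1] a = a) (hZ : twistedTrace σ a m ≠ 0) :
    twistedSeq σ a (m + 1) ≠ 0 := by
  intro hs
  have h1 := twistedSeq_add_two' σ a m
  have h2 := map_twistedSeq_add_two σ a m
  have h3 := twistedSeq_add_two' σ a (m + 1)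
  have h4 := twistedSeq_add_two σ a (m + 1)
  rw [ha] at h2 h4
  rw [hs] at h1 h2 h3 h4
  simp only [map_zero, mul_zero, add_zero, zero_add] at h1 h2 h3 h4
  apply hZ
  rw [twistedTrace]
  grind

/-- A zero gives a root of the characteristic polynomial. -/
lemma twistedProd_charpoly {x : F} (hxm : σ^[m + 1] x = x)
    (hx : x * σ x = x + a) :
    twistedProd σ (m + 1) x ^ 2 + twistedTrace σ a m * twistedProd σ (m + 1) x +
      twistedProd σ (m + 1) a = 0 := by
  have h1 := twistedSeq_eigen σ hx m
  have h2 := twistedSeq_eigen σ hx (m + 1)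
  have h3 := twistedSeq_det σ a m
  rw [twistedProd_succ _ (m + 1), hxm] at h2
  rw [twistedTrace]
  grind

/-- An eigenvalue fixed by `σ` gives a zero. -/
lemma isZero_of_eigenvalue (hs : twistedSeq σ a (m + 1) ≠ 0) {r x : F}
    (hr : σ r = r)
    (hchar : r ^ 2 + twistedTrace σ a m * r + twistedProd σ (m + 1) a = 0)
    (hx : twistedSeq σ a (m + 1) * x + a * σ (twistedSeq σ a m) = r) :
    x * σ x = x + a := by
  have h1 := twistedSeq_add_two' σ a m
  have h3 := twistedSeq_det σ a m
  have h4 := congrArg σ hx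
  simp only [map_add, map_mul, hr] at h4
  rw [twistedTrace] at hchar
  have hs' : σ (twistedSeq σ a (m + 1)) ≠ 0 := (map_ne_zero σ).2 hs
  apply mul_left_cancel₀ (mul_ne_zero hs hs')
  generalize twistedSeq σ a (m + 1) = s at *
  generalize twistedSeq σ a (m + 2) = p at *
  generalize σ (twistedSeq σ a m) = u at *
  generalize σ s = s' at *
  generalize σ x = x' at *
  generalize σ u = u' at *
  generalize σ a = a' at *
  generalize twistedProd σ (m + 1) a = N at *
  have e1 : s * x = r + a * u := by grind
  have e2 : s' * x' = r + a' * u' := by grind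
  have e3 : a' * u' = p + s' := by grind
  have : s * s' * (x * x') = (s * x) * (s' * x') := by ring
  rw [this, e2, e3]
  have : s * s' * (x + a) = s' * (s * x) + a * s' * s := by ring
  rw [this, e1]
  grind

/-- Two zeros with quotient of the form `σ(w) / w` give rise to a third one. -/
lemma exists_third_zero {x y w : F} (hx : x * σ x = x + a) (hy : y * σ y = y + a)
    (hxy : x ≠ y) (hw : w ≠ 0) (h : x * σ w = w * y) :
    ∃ z, z * σ z = z + a ∧ z ≠ x ∧ z ≠ y := by
  have hw1 : 1 + w ≠ 0 := by
    intro h1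
    have : w = 1 := by grind
    subst this
    apply hxy
    simpa using h
  have hw2 : 1 + σ w ≠ 0 := by simpa using (map_ne_zero σ).2 hw1
  -- By `h`, both `(x, 1)` and `w (y, 1)` solve the semilinear equation `A v = x σ(v)`; so does
  -- their sum.
  refine ⟨(x + w * y) / (1 + w), ?_, ?_, ?_⟩
  · simp only [map_div₀, map_add, map_mul, map_one]
    field_simp
    grind
  · intro e
    rw [div_eq_iff hw1] at e
    apply hxy
    apply mul_left_cancel₀ hw
    grind
  · intro e
    rw [div_eq_iff hw1] at e
    apply hxy
    grind

/-- The zeros in terms of the eigenvalues `t Z` and `(t + 1) Z`. -/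
lemma setOf_zeros_eq (hfix : ∀ x, σ^[m + 1] x = x) (hZ : twistedTrace σ a m ≠ 0) {t : F}
    (ht : t ^ 2 + t = twistedProd σ (m + 1) a / twistedTrace σ a m ^ 2) (hσt : σ t = t) :
    {x | x * σ x = x + a} = {x | ∃ μ : F, (μ = 0 ∨ μ = 1) ∧
      x = (twistedSeq σ a (m + 2) / twistedTrace σ a m + t + μ) * twistedTrace σ a m /
        twistedSeq σ a (m + 1)} := by
  have hs := twistedSeq_ne_zero (hfix a) hZ
  have hσZ := map_twistedTrace (m := m) (hfix a)
  have hN : twistedProd σ (m + 1) a = (t ^ 2 + t) * twistedTrace σ a m ^ 2 := by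
    rw [ht, div_mul_cancel₀ _ (pow_ne_zero 2 hZ)]
  -- The shift by 1 comes from `c_{m+2} = Z + a σ(c_m)`.
  have key : ∀ x μ : F, x = (twistedSeq σ a (m + 2) / twistedTrace σ a m + t + μ) *
      twistedTrace σ a m / twistedSeq σ a (m + 1) ↔
      twistedSeq σ a (m + 1) * x + a * σ (twistedSeq σ a m) =
        (t + μ + 1) * twistedTrace σ a m := by
    intro x μ
    rw [eq_div_iff hs, add_assoc, add_mul, div_mul_cancel₀ _ hZ]
    have : twistedTrace σ a m = twistedSeq σ a (m + 2) + a * σ (twistedSeq σ a m) := rfl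
    constructor <;> intro h <;> grind
  ext x
  simp only [Set.mem_ofPred_eq, key]
  constructor
  · intro hx
    have h1 := twistedProd_charpoly (hfix x) hx
    rw [hN, ← twistedSeq_eigen σ hx m] at h1
    generalize twistedSeq σ a (m + 1) * x + a * σ (twistedSeq σ a m) = r at h1 ⊢
    have h2 : (r + t * twistedTrace σ a m) * (r + (t + 1) * twistedTrace σ a m) = 0 := by grind
    rcases mul_eq_zero.1 h2 with h | h
    · exact ⟨1, Or.inr rfl, by grind⟩
    · exact ⟨0, Or.inl rfl, by grind⟩
  · rintro ⟨μ, hμ, hx⟩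
    refine isZero_of_eigenvalue hs ?_ ?_ hx
    · rcases hμ with rfl | rfl <;> simp [hσt, hσZ]
    · rw [hN]
      rcases hμ with rfl | rfl <;> grind

end Twisted

/-! ### Norms, traces and Hilbert 90 over finite fields. -/

section FiniteField

variable {F : Type*} [Field F]

/-- In an extension of a finite field of order `q`, the solutions of `y ^ q = y` lie in the
field. -/
lemma exists_algebraMap_eq_of_pow_card [Fintype F] {L : Type*} [Field L] [Algebra F L] {y : L}
    (hy : y ^ Fintype.card F = y) : ∃ x : F, algebraMap F L x = y := by
  have h1 : 1 < Fintype.card F := Fintype.one_lt_card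
  have hs : (X ^ Fintype.card F - X : F[X]).Splits := by
    rw [splits_iff_card_roots, FiniteField.roots_X_pow_card_sub_X,
      FiniteField.X_pow_card_sub_X_natDegree_eq F h1]
    rfl
  have := hs.mem_range_of_isRoot (FiniteField.X_pow_card_sub_X_ne_zero F h1)
    (i := algebraMap F L) (x := y) (by simp [IsRoot, hy])
  exact this

lemma iterate_iterateFrobenius_apply [CharP F 2] (l i : ℕ) (x : F) :
    (iterateFrobenius F 2 l)^[i] x = x ^ 2 ^ (i * l) := by
  rw [← iterateFrobenius_mul_apply, iterateFrobenius_def, mul_comm]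

lemma twistedProd_iterateFrobenius [CharP F 2] (l n : ℕ) (x : F) :
    twistedProd (iterateFrobenius F 2 l) n x = ∏ i ∈ Finset.range n, x ^ 2 ^ (i * l) := by
  simp only [twistedProd, iterate_iterateFrobenius_apply]

lemma pow_two_pow_mod {k : ℕ} {x : F} (hx : x ^ 2 ^ k = x) (m : ℕ) :
    x ^ 2 ^ (m % k) = x ^ 2 ^ m := by
  have h : ∀ j : ℕ, x ^ 2 ^ (k * j) = x := by
    intro j
    induction j with
    | zero => simp
    | succ j ih => rw [Nat.mul_succ, pow_add, pow_mul, ih, hx]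
  conv_rhs => rw [← Nat.div_add_mod m k, pow_add, pow_mul, h]

lemma pow_two_pow_gcd {l k : ℕ} {x : F} (hl : x ^ 2 ^ l = x) (hk : x ^ 2 ^ k = x) :
    x ^ 2 ^ Nat.gcd l k = x := by
  have h : ∀ m, Function.IsPeriodicPt (fun y : F => y ^ 2) m x ↔ x ^ 2 ^ m = x := fun m => by
    rw [Function.IsPeriodicPt, Function.IsFixedPt, pow_iterate]
  exact (h _).1 (((h l).2 hl).gcd ((h k).2 hk))

/-- The norm may be computed with any generator of the Galois group. -/
lemma prod_pow_two_pow_mul_eq {n d l : ℕ} (hn : 0 < n) (hd : 0 < d) (hg : Nat.gcd l (n * d) = d)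
    {x : F} (hx : x ^ 2 ^ (n * d) = x) :
    ∏ i ∈ Finset.range n, x ^ 2 ^ (i * l) = ∏ i ∈ Finset.range n, x ^ 2 ^ (i * d) := by
  obtain ⟨e, rfl⟩ : d ∣ l := hg ▸ Nat.gcd_dvd_left _ _
  have hc : Nat.Coprime n e := by
    rw [mul_comm n d, Nat.gcd_mul_left] at hg
    exact Nat.Coprime.symm (Nat.eq_of_mul_eq_mul_left hd (by simpa using hg))
  have hmaps : Set.MapsTo (fun i => i * e % n) (Finset.range n) (Finset.range n) := fun i _ => by
    simpa using Nat.mod_lt _ hn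
  have hinj : Set.InjOn (fun i => i * e % n) (Finset.range n) := fun i hi j hj hij => by
    have := Nat.ModEq.cancel_right_of_coprime (m := n) (c := e) hc hij
    simp only [Finset.coe_range, Set.mem_Iio] at hi hj
    rwa [Nat.ModEq, Nat.mod_eq_of_lt hi, Nat.mod_eq_of_lt hj] at this
  refine Finset.prod_nbij (fun i => i * e % n) hmaps hinj
    (Finset.surjOn_of_injOn_of_card_le _ hmaps hinj le_rfl) fun i _ => ?_
  rw [← Nat.mul_mod_mul_right, pow_two_pow_mod hx]
  ring_nf

lemma sum_sq_add_self [CharP F 2] (t : F) (m : ℕ) :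
    ∑ i ∈ Finset.range m, (t ^ 2 + t) ^ 2 ^ i = t ^ 2 ^ m + t := by
  induction m with
  | zero => simp [CharTwo.add_self_eq_zero]
  | succ m ih =>
    rw [Finset.sum_range_succ, ih, add_pow_char_pow, ← pow_mul, ← pow_succ']
    grind

variable [Fintype F]

/-- Hilbert's theorem 90 for the extension of finite fields `GF(2^(nd)) / GF(2^d)`. -/
lemma exists_pow_eq_of_norm_eq_one {n d : ℕ} (hF : Fintype.card F = 2 ^ (n * d)) (hd : 0 < d)
    {z : F} (hz : ∏ i ∈ Finset.range n, z ^ 2 ^ (i * d) = 1) : ∃ w : F, w ^ (2 ^ d - 1) = z := by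
  have hpos : 0 < 2 ^ d - 1 := Nat.sub_pos_of_lt (Nat.one_lt_two_pow hd.ne')
  obtain ⟨w, hw⟩ := IsAlgClosed.exists_pow_nat_eq (algebraMap F (AlgebraicClosure F) z) hpos
  have hw' : w ^ 2 ^ d = algebraMap F (AlgebraicClosure F) z * w := by
    rw [← hw, ← pow_succ, Nat.sub_add_cancel Nat.one_le_two_pow]
  -- At `m = n` the norm is 1, so `w` is fixed by the Frobenius of `F` and descends to `F`.
  have h : ∀ m, w ^ 2 ^ (m * d) =
      algebraMap F (AlgebraicClosure F) (∏ i ∈ Finset.range m, z ^ 2 ^ (i * d)) * w := by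
    intro m
    induction m with
    | zero => simp
    | succ m ih =>
      rw [add_mul, one_mul, add_comm, pow_add, pow_mul, hw', mul_pow, ih, Finset.prod_range_succ,
        map_mul, map_pow]
      ring
  have hn := h n
  rw [hz, map_one, one_mul, ← hF] at hn
  obtain ⟨v, rfl⟩ := exists_algebraMap_eq_of_pow_card hn
  exact ⟨v, (algebraMap F (AlgebraicClosure F)).injective (by rw [map_pow, hw])⟩

/-- Hilbert's theorem 90 for the automorphism `x ↦ x ^ (2 ^ l)` of `GF(2^k)`. -/
lemma exists_pow_two_pow_eq_mul {n d l : ℕ} (hF : Fintype.card F = 2 ^ (n * d)) (hn : 0 < n)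
    (hd : 0 < d) (hg : Nat.gcd l (n * d) = d) {z : F}
    (hz : ∏ i ∈ Finset.range n, z ^ 2 ^ (i * l) = 1) : ∃ w : F, w ≠ 0 ∧ w ^ 2 ^ l = z * w := by
  have hzk : z ^ 2 ^ (n * d) = z := hF ▸ FiniteField.pow_card z
  rw [prod_pow_two_pow_mul_eq hn hd hg hzk] at hz
  have hz0 : z ≠ 0 := by
    rintro rfl
    rw [Finset.prod_eq_zero (i := 0) (Finset.mem_range.2 hn) (by simp)] at hz
    exact zero_ne_one hz
  obtain ⟨w, hw⟩ := exists_pow_eq_of_norm_eq_one hF hd hz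
  have hpos : 2 ^ d - 1 ≠ 0 := (Nat.sub_pos_of_lt (Nat.one_lt_two_pow hd.ne')).ne'
  have hw0 : w ≠ 0 := by
    rintro rfl
    exact hz0 (by rw [← hw, zero_pow hpos])
  have hgcd : Nat.gcd (2 ^ l - 1) (2 ^ (n * d) - 1) = 2 ^ d - 1 := by
    rw [Nat.pow_sub_one_gcd_pow_sub_one, hg]
  have hcard : w ^ (2 ^ (n * d) - 1) = 1 := hF ▸ FiniteField.pow_card_sub_one_eq_one w hw0
  -- Bézout: modulo `2^(nd) - 1`, this exponent times `2^l - 1` is `2^d - 1`.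
  refine ⟨w ^ Nat.gcdA (2 ^ l - 1) (2 ^ (n * d) - 1), zpow_ne_zero _ hw0, ?_⟩
  have key : (w ^ Nat.gcdA (2 ^ l - 1) (2 ^ (n * d) - 1)) ^ (2 ^ l - 1) = z := by
    rw [← hw, ← zpow_natCast w, ← hgcd, Nat.gcd_eq_gcd_ab, zpow_add₀ hw0, zpow_mul w
      ((2 ^ (n * d) - 1 : ℕ) : ℤ), zpow_natCast w (2 ^ (n * d) - 1), hcard, one_zpow, mul_one,
      ← zpow_natCast, ← zpow_mul, mul_comm]
  generalize w ^ Nat.gcdA (2 ^ l - 1) (2 ^ (n * d) - 1) = v at key ⊢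
  rw [← key, ← pow_succ, Nat.sub_add_cancel Nat.one_le_two_pow]

/-- Additive form of Hilbert's theorem 90 for the Artin-Schreier equation. -/
lemma exists_sq_add_self_eq [CharP F 2] {n d : ℕ} (hF : Fintype.card F = 2 ^ (n * d)) {e : F}
    (he : ∑ i ∈ Finset.range d, e ^ 2 ^ i = 0) : ∃ t : F, t ^ 2 + t = e ∧ t ^ 2 ^ d = t := by
  have : CharP (AlgebraicClosure F) 2 := charP_of_injective_algebraMap
    (algebraMap F (AlgebraicClosure F)).injective 2
  obtain ⟨t, ht⟩ := IsAlgClosed.exists_root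
    (X ^ 2 + X + C (algebraMap F (AlgebraicClosure F) e)) (by
      have : (X ^ 2 + X + C (algebraMap F (AlgebraicClosure F) e)).degree = 2 := by
        compute_degree!
      rw [this]
      decide)
  have ht' : t ^ 2 + t = algebraMap F (AlgebraicClosure F) e := by
    simp only [IsRoot, eval_add, eval_pow, eval_X, eval_C] at ht
    grind
  -- The trace of `t^2 + t` telescopes to `t^(2^d) + t`.
  have htd : t ^ 2 ^ d = t := by
    have := sum_sq_add_self t d
    simp only [ht', ← map_pow, ← map_sum, he, map_zero] at this
    grind
  have htn : ∀ m, t ^ 2 ^ (m * d) = t := by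
    intro m
    induction m with
    | zero => simp
    | succ m ih => rw [add_mul, one_mul, pow_add, pow_mul, ih, htd]
  obtain ⟨u, rfl⟩ := exists_algebraMap_eq_of_pow_card (F := F) (y := t) (hF ▸ htn n)
  have hinj := (algebraMap F (AlgebraicClosure F)).injective
  exact ⟨u, hinj (by simpa using ht'), hinj (by simpa using htd)⟩

end FiniteField

/-! ### Zeros of `P_a` and the degenerate case `Z_n = 0`. -/

section Zeros

variable {F : Type*} [Field F] [CharP F 2]

lemma eval_polyC (l : ℕ) (a : F) (i : ℕ) :
    (polyC F l i).eval a = twistedSeq (iterateFrobenius F 2 l) a i := by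
  induction i using Nat.twoStepInduction with
  | zero => simp [polyC, twistedSeq]
  | one => simp [polyC, twistedSeq]
  | more i h1 h2 =>
    rcases i with _ | i
    · simp [polyC, twistedSeq]
    · rw [twistedSeq_add_two, ← h1, ← h2, iterate_iterateFrobenius_apply]
      simp [polyC]

lemma eval_polyZ (l : ℕ) (a : F) (m : ℕ) :
    (polyZ F l (m + 2)).eval a = twistedTrace (iterateFrobenius F 2 l) a (m + 1) := by
  simp [polyZ, twistedTrace, eval_polyC, iterateFrobenius_def]

lemma setOf_isRoot_polyP (l : ℕ) (a : F) :
    {x : F | (polyP l a).IsRoot x} = {x | x * iterateFrobenius F 2 l x = x + a} := by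
  ext x
  simp only [polyP, IsRoot, Set.mem_ofPred_eq, eval_add, eval_pow, eval_X, eval_C,
    iterateFrobenius_def, pow_succ' x]
  constructor <;> intro h <;> grind

omit [CharP F 2] in
lemma ncard_setOf_zero_or_one (f : F → F) (hf : f 0 ≠ f 1) :
    {x : F | ∃ μ : F, (μ = 0 ∨ μ = 1) ∧ x = f μ}.ncard = 2 := by
  rw [← Set.ncard_pair hf]
  congr 1
  ext x
  simp

/-- A zero of `P_a` provides a root in the fixed field of `t ^ 2 + t = N / Z ^ 2`. -/
lemma exists_sq_add_self_eq_of_zero {σ : F →+* F} {a x : F} {m : ℕ}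
    (hfix : ∀ x, σ^[m + 1] x = x) (hZ : twistedTrace σ a m ≠ 0) (hx : x * σ x = x + a) :
    ∃ t, t ^ 2 + t = twistedProd σ (m + 1) a / twistedTrace σ a m ^ 2 ∧ σ t = t := by
  refine ⟨twistedProd σ (m + 1) x / twistedTrace σ a m, ?_, ?_⟩
  · have := twistedProd_charpoly (hfix x) hx
    field_simp
    grind
  · rw [map_div₀, map_twistedProd σ (hfix x), map_twistedTrace (hfix a)]

/-- For odd `d = 2m + 1` and `e` in `GF(2^d)` of trace 0, the right side is `e`: an explicit
Artin-Schreier root. -/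
lemma sum_pow_four_pow_sq_add_self (e : F) (m : ℕ) :
    (∑ i ∈ Finset.range (m + 1), e ^ 2 ^ (2 * i)) ^ 2 +
      ∑ i ∈ Finset.range (m + 1), e ^ 2 ^ (2 * i) =
      ∑ i ∈ Finset.range (2 * m + 1), e ^ 2 ^ i + e ^ 2 ^ (2 * m + 1) := by
  induction m with
  | zero => simp; ring
  | succ m ih =>
    have h : e ^ 2 ^ (2 * (m + 1) + 1) = (e ^ 2 ^ (2 * (m + 1))) ^ 2 := by
      rw [pow_succ 2, pow_mul]
    rw [Finset.sum_range_succ, h, Finset.sum_range_succ _ (2 * (m + 1)),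
      show 2 * (m + 1) = 2 * m + 1 + 1 by ring, Finset.sum_range_succ _ (2 * m + 1), ← ih,
      CharTwo.add_sq]
    ring

variable [Fintype F]

/-- If the twisted trace vanishes, then `P_a` does not have exactly two zeros. -/
lemma twistedTrace_ne_zero_of_ncard_eq_two {n d l m : ℕ} (hF : Fintype.card F = 2 ^ (n * d))
    (hnm : n = m + 1) (hd : 0 < d) (hg : Nat.gcd l (n * d) = d) {a : F} (ha : a ≠ 0)
    (hfix : ∀ x, (iterateFrobenius F 2 l)^[m + 1] x = x)
    (h : {x : F | x * iterateFrobenius F 2 l x = x + a}.ncard = 2) :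
    twistedTrace (iterateFrobenius F 2 l) a m ≠ 0 := by
  intro hZ
  obtain ⟨x, y, hxy, hset⟩ := Set.ncard_eq_two.1 h
  have hx : x * iterateFrobenius F 2 l x = x + a := by
    have : x ∈ ({x, y} : Set F) := by simp
    rwa [← hset] at this
  have hy : y * iterateFrobenius F 2 l y = y + a := by
    have : y ∈ ({x, y} : Set F) := by simp
    rwa [← hset] at this
  have hx0 : x ≠ 0 := by
    rintro rfl
    exact ha (by simpa using hx.symm)
  have h1 := twistedProd_charpoly (hfix x) hx
  have h2 := twistedProd_charpoly (hfix y) hy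
  rw [hZ, zero_mul, add_zero] at h1 h2
  have h3 : twistedProd (iterateFrobenius F 2 l) n y = twistedProd (iterateFrobenius F 2 l) n x := by
    subst hnm
    refine CharTwo.sq_injective ?_
    grind
  have h4 : ∏ i ∈ Finset.range n, (y / x) ^ 2 ^ (i * l) = 1 := by
    rw [← twistedProd_iterateFrobenius, twistedProd_div, h3, div_self (twistedProd_ne_zero _ _ hx0)]
  obtain ⟨w, hw, hwz⟩ := exists_pow_two_pow_eq_mul hF (by lia) hd hg h4
  obtain ⟨z, hz, hzx, hzy⟩ := exists_third_zero hx hy hxy hw (by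
    rw [iterateFrobenius_def, hwz]
    field_simp)
  have : z ∈ ({x, y} : Set F) := by rw [← hset]; exact hz
  rcases this with h | h
  exacts [hzx h, hzy h]

end Zeros

end HellesethKholosha

open HellesethKholosha

theorem mainTheorem3 {F : Type*} [Field F] [Fintype F] (k l d n : ℕ)
    (hF : Fintype.card F = 2 ^ k) (hl : 0 < l) (hlk : l < k)
    (hd : d = Nat.gcd l k) (hn : k = n * d) (a : F) (ha : a ≠ 0) :
    ({x : F | (HellesethKholosha.polyP l a).IsRoot x}.ncard = 2 ↔
      (HellesethKholosha.polyZ F l n).eval a ≠ 0 ∧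
        HellesethKholosha.absTr d (HellesethKholosha.normQuot l k d n a) = 0) ∧
    (Odd d → {x : F | (HellesethKholosha.polyP l a).IsRoot x}.ncard = 2 →
      (HellesethKholosha.polyC F l n).eval a ≠ 0 ∧
      {x : F | (HellesethKholosha.polyP l a).IsRoot x} =
        {x : F | ∃ μ : F, (μ = 0 ∨ μ = 1) ∧
          x = (HellesethKholosha.elemW l k d n a + μ) * (HellesethKholosha.polyZ F l n).eval a /
            (HellesethKholosha.polyC F l n).eval a}) := by
  have : CharP F 2 := charP_of_card_eq_prime_pow hF
  have hd0 : 0 < d := hd ▸ Nat.gcd_pos_of_pos_left _ hl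
  have hdl : d ≤ l := hd ▸ Nat.gcd_le_left _ hl
  subst hn
  have hn1 : 1 < n := by
    by_contra! h
    have := Nat.mul_le_mul_right d h
    lia
  obtain ⟨m, rfl⟩ : ∃ m, n = m + 2 := ⟨n - 2, by lia⟩
  have hcard : ∀ x : F, x ^ 2 ^ ((m + 2) * d) = x := fun x => hF ▸ FiniteField.pow_card x
  obtain ⟨e, he⟩ : d ∣ l := hd ▸ Nat.gcd_dvd_left _ _
  set σ := iterateFrobenius F 2 l with hσ
  have hiter : ∀ (x : F) (j c : ℕ), x ^ 2 ^ c = x → x ^ 2 ^ (c * j) = x := by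
    intro x j c h
    rw [← pow_two_pow_mod h, Nat.mul_mod_right, pow_zero, pow_one]
  have hfix : ∀ x, σ^[m + 1 + 1] x = x := by
    intro x
    rw [hσ, iterate_iterateFrobenius_apply, he, ← mul_assoc]
    exact hiter x e _ (hcard x)
  have hσd : ∀ x : F, σ x = x ↔ x ^ 2 ^ d = x := by
    intro x
    rw [hσ, iterateFrobenius_def]
    refine ⟨fun h => ?_, fun h => ?_⟩
    · rw [hd]
      exact pow_two_pow_gcd h (hcard x)
    · rw [he]
      exact hiter x e d h
  have hnorm : normMap d ((m + 2) * d) a = twistedProd σ (m + 1 + 1) a := by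
    rw [normMap, Nat.mul_div_cancel _ hd0, hσ, twistedProd_iterateFrobenius]
    exact (prod_pow_two_pow_mul_eq (by lia) hd0 hd.symm (hcard a)).symm
  have hquot : normQuot l ((m + 2) * d) d (m + 2) a =
      twistedProd σ (m + 1 + 1) a / twistedTrace σ a (m + 1) ^ 2 := by
    rw [normQuot, hnorm, eval_polyZ]
  have hσquot : σ (normQuot l ((m + 2) * d) d (m + 2) a) =
      normQuot l ((m + 2) * d) d (m + 2) a := by
    rw [hquot, map_div₀, map_pow, map_twistedProd σ (hfix a), map_twistedTrace (hfix a)]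
  have htr : ∀ x : F, absTr d x = ∑ i ∈ Finset.range d, x ^ 2 ^ i := by
    intro x
    simp [absTr, trMap]
  have hmain : {x : F | (polyP l a).IsRoot x}.ncard = 2 ↔
      (polyZ F l (m + 2)).eval a ≠ 0 ∧ absTr d (normQuot l ((m + 2) * d) d (m + 2) a) = 0 := by
    rw [setOf_isRoot_polyP, eval_polyZ, htr]
    constructor
    · intro h
      have hZ := twistedTrace_ne_zero_of_ncard_eq_two hF rfl hd0 hd.symm ha hfix h
      obtain ⟨x, hx⟩ := Set.nonempty_of_ncard_ne_zero (h ▸ two_ne_zero)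
      obtain ⟨t, ht, hσt⟩ := exists_sq_add_self_eq_of_zero hfix hZ hx
      refine ⟨hZ, ?_⟩
      rw [hquot, ← ht, sum_sq_add_self, (hσd t).1 hσt, CharTwo.add_self_eq_zero]
    · rintro ⟨hZ, h⟩
      obtain ⟨t, ht, htd⟩ := exists_sq_add_self_eq hF h
      have hs := twistedSeq_ne_zero (hfix a) hZ
      rw [setOf_zeros_eq hfix hZ (ht.trans hquot) ((hσd t).2 htd)]
      refine ncard_setOf_zero_or_one (fun μ => (twistedSeq σ a (m + 1 + 2) /
        twistedTrace σ a (m + 1) + t + μ) * twistedTrace σ a (m + 1) /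
          twistedSeq σ a (m + 1 + 1)) ?_
      intro h
      rw [div_left_inj' hs, mul_left_inj' hZ, add_right_inj] at h
      exact zero_ne_one h
  refine ⟨hmain, fun ⟨j, hj⟩ h => ?_⟩
  obtain ⟨hZ, htr0⟩ := hmain.1 h
  rw [eval_polyZ] at hZ
  rw [htr] at htr0
  have hj' : (d - 1) / 2 + 1 = j + 1 := by lia
  have ht := sum_pow_four_pow_sq_add_self (normQuot l ((m + 2) * d) d (m + 2) a) j
  rw [← hj, htr0, zero_add, (hσd _).1 hσquot, ← hj'] at ht
  rw [setOf_isRoot_polyP, eval_polyZ, eval_polyC]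
  refine ⟨twistedSeq_ne_zero (hfix a) hZ, ?_⟩
  rw [setOf_zeros_eq hfix hZ (ht.trans hquot), elemW, eval_polyZ, eval_polyC]
  -- What remains is that the explicit `t` is fixed by `σ`.
  rw [map_sum]
  exact Finset.sum_congr rfl fun i _ => by rw [map_pow, hσquot]
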